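/- Let $(R,\mathfrak m)$ be a commutative Noetherian local ring. An $R$-module $N$ is called divisible if $rN=N$ for every non-zero-divisor $r\in R$, and simple divisible if it is nonzero and divisible and no submodule $U$ with $0\neq U\subsetneq N$ is divisible. A submodule of a module is called essential if it meets every nonzero submodule nontrivially. For a Noetherian local ring $A$, let $\widehat A$ be its completion with respect to its maximal ideal; $A$ is called analytically irreducible if $\widehat A$ is an integral domain, and essentially complete if for every ideal $I$ of $\widehat A$ that is essential in $\widehat A$, the contraction $I\cap A$ (the preimage of $I$ under $A\to\widehat A$) is essential in $A$. Let $\mathfrak q$ be a prime ideal of $R$ and let $E(R/\mathfrak q)$ be the injective hull of the $R$-module $R/\mathfrak q$. Consider the conditions: (i) $E(R/\mathfrak q)$ is simple divisible as an $R$-module; (ii) the local ring $R_{\mathfrak q}$ is analytically irreducible and essentially complete. Then (i) implies (ii); and if the canonical map $R\to R_{\mathfrak q}$ is injective, then also (ii) implies (i). -/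

import Mathlib

universe u

section Modules

variable (R : Type*) [CommRing R] (N : Type*) [AddCommGroup N] [Module R N]

/-- `N` is divisible: every non-zero-divisor `r` of `R` satisfies `r N = N`. -/
def IsDivisibleModule : Prop :=
  ∀ r ∈ nonZeroDivisors R, Function.Surjective fun x : N => r • x

/-- `N` is simple divisible: `N` is nonzero and divisible, and no submodule `U` of `N` with
`0 ≠ U ≠ N` is divisible. -/
structure IsSimpleDivisible : Prop where
  nontrivial : Nontrivial N
  divisible : IsDivisibleModule R N
  not_divisible : ∀ U : Submodule R N, U ≠ ⊥ → U ≠ ⊤ → ¬ IsDivisibleModule R U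

variable {R N}

/-- A submodule `U` is essential (large): it meets every nonzero submodule nontrivially. -/
def IsEssentialSubmodule (U : Submodule R N) : Prop :=
  ∀ V : Submodule R N, V ≠ ⊥ → U ⊓ V ≠ ⊥

end Modules

/-- `i : M → E` is an injective hull of `M`: `E` is an injective module, `i` is injective, and the
image of `i` is essential in `E`. -/
structure IsInjectiveHull {R : Type*} [CommRing R] {M : Type*} [AddCommGroup M] [Module R M]
    {E : Type*} [AddCommGroup E] [Module R E] (i : M →ₗ[R] E) : Prop where
  injective_module : Module.Injective R E
  injective : Function.Injective i
  essential : IsEssentialSubmodule (LinearMap.range i)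

section LocalRings

variable (A : Type*) [CommRing A] [IsLocalRing A]

/-- The completion of a local ring with respect to its maximal ideal. -/
abbrev LocalCompletion : Type _ := AdicCompletion (IsLocalRing.maximalIdeal A) A

/-- `A` is analytically irreducible: its completion is an integral domain. -/
def IsAnalyticallyIrreducible : Prop := IsDomain (LocalCompletion A)

/-- `A` is essentially complete: every essential ideal of the completion contracts to an essential
ideal of `A`. -/
def IsEssentiallyComplete : Prop :=
  ∀ I : Ideal (LocalCompletion A), IsEssentialSubmodule I →
    IsEssentialSubmodule (I.comap (algebraMap A (LocalCompletion A)))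

end LocalRings

open IsLocalRing

/-! Put `A = R_q`. Elements outside `q` act bijectively on `E = E(R/q)`, so `E` is an `A`-module,
and it is the injective hull of the residue field of `A`. Matlis theory identifies `End_A(E)` with
the completion `Â` (`completionToEnd_injective`, `completionToEnd_surjective`) and shows that `E` is
Artinian (`isArtinian`).

If `E` is simple divisible, every nonzero `f ∈ Â` has a nonzero divisible image, hence is surjective
on `E`; so `Â` is a domain. Among the submodules `s • ker f`, with `s` a non-zero-divisor of `R`, a
minimal one is divisible and proper, hence zero. Then `f ∣ s` by `dvd_of_ker_le`, and nonzero ideals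
of `Â` contract to nonzero ideals of `A`.

Conversely, a proper divisible submodule is killed by some nonzero `f ∈ Â`, hence by a nonzero
element of `(f) ∩ A`; being divisible, it is zero. -/

/-- `E` is an injective module over the local ring `A` whose socle is generated by `e ≠ 0`, and all
of whose elements are killed by a power of the maximal ideal: an injective hull of the residue
field. -/
structure IsMatlisModule (A : Type u) [CommRing A] [IsLocalRing A] {E : Type u} [AddCommGroup E]
    [Module A E] (e : E) : Prop where
  injective : Module.Injective A E
  ne_zero : e ≠ 0
  smul_eq_zero : ∀ a ∈ maximalIdeal A, a • e = 0
  socle : ∀ x : E, (∀ a ∈ maximalIdeal A, a • x = 0) → ∃ c : A, x = c • e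
  torsion : ∀ x : E, ∃ n, ∀ a ∈ maximalIdeal A ^ n, a • x = 0

/-! ### Maps into an injective module and separation of elements -/

section Factor

variable {A E M P : Type u} [CommRing A] [AddCommGroup E] [Module A E]
  [AddCommGroup M] [Module A M] [AddCommGroup P] [Module A P]

theorem Module.Injective.exists_factor (hE : Module.Injective A E) (f : M →ₗ[A] P) (g : M →ₗ[A] E)
    (h : LinearMap.ker f ≤ LinearMap.ker g) : ∃ k : P →ₗ[A] E, ∀ x, k (f x) = g x := by
  obtain ⟨k, hk⟩ := hE.out ((LinearMap.ker f).liftQ f le_rfl)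
    (LinearMap.ker_eq_bot.mp (Submodule.ker_liftQ_eq_bot _ _ _ le_rfl))
    ((LinearMap.ker f).liftQ g h)
  exact ⟨k, fun x => by simpa using hk (Submodule.Quotient.mk x)⟩

end Factor

namespace IsMatlisModule

section KilledBy

variable {A E : Type u} [CommRing A] [AddCommGroup E] [Module A E]

/-- The elements of `E` killed by the ideal `I`. -/
def killedBy (E : Type u) [AddCommGroup E] [Module A E] (I : Ideal A) : Submodule A E where
  carrier := {x | ∀ b ∈ I, b • x = 0}
  add_mem' hx hy b hb := by rw [smul_add, hx b hb, hy b hb, add_zero]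
  zero_mem' b _ := smul_zero b
  smul_mem' c x hx b hb := by rw [smul_comm, hx b hb, smul_zero]

theorem killedBy_anti {I J : Ideal A} (h : I ≤ J) : killedBy E J ≤ killedBy E I :=
  fun _ hx b hb => hx b (h hb)

end KilledBy

variable {A E : Type u} [CommRing A] [IsLocalRing A] [AddCommGroup E] [Module A E] {e : E}

/-- The annihilator of `x` lies in the maximal ideal, which kills `e`; so `x ↦ e` is well defined on
`A x` and extends by injectivity. -/
theorem exists_apply_ne_zero (hE : IsMatlisModule A e) {M : Type u} [AddCommGroup M] [Module A M]
    {x : M} (hx : x ≠ 0) : ∃ φ : M →ₗ[A] E, φ x ≠ 0 := by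
  obtain ⟨k, hk⟩ := hE.injective.exists_factor (LinearMap.toSpanSingleton A M x)
    (LinearMap.toSpanSingleton A E e) (by
      intro a ha
      rw [LinearMap.mem_ker, LinearMap.toSpanSingleton_apply] at ha ⊢
      refine hE.smul_eq_zero a ((mem_maximalIdeal a).mpr fun hu => hx ?_)
      exact hu.smul_eq_zero.mp ha)
  refine ⟨k, ?_⟩
  have := hk 1
  simp only [LinearMap.toSpanSingleton_apply, one_smul] at this
  rw [this]
  exact hE.ne_zero

/-- A proper submodule is killed by some linear map to `E` not killing a given outside element. -/
theorem exists_apply_ne_zero_of_notMem (hE : IsMatlisModule A e) {M : Type u} [AddCommGroup M]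
    [Module A M] {U : Submodule A M} {x : M} (hx : x ∉ U) :
    ∃ φ : M →ₗ[A] E, (∀ u ∈ U, φ u = 0) ∧ φ x ≠ 0 := by
  obtain ⟨φ, hφ⟩ := hE.exists_apply_ne_zero (M := M ⧸ U) (x := U.mkQ x) (by simpa using hx)
  refine ⟨φ ∘ₗ U.mkQ, fun u hu => ?_, hφ⟩
  have : U.mkQ u = 0 := by simpa using hu
  rw [LinearMap.comp_apply, this, map_zero]

theorem mem_of_forall_smul_eq_zero (hE : IsMatlisModule A e) {I : Ideal A} {a : A}
    (h : ∀ x : E, (∀ b ∈ I, b • x = 0) → a • x = 0) : a ∈ I := by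
  by_contra ha
  obtain ⟨φ, h1, h2⟩ := hE.exists_apply_ne_zero_of_notMem (U := I) ha
  apply h2
  have key : ∀ b, φ b = b • φ 1 := fun b => by rw [← map_smul, smul_eq_mul, mul_one]
  rw [key]
  exact h _ fun b hb => by rw [← key]; exact h1 b hb

/-- An ideal containing a power of the maximal ideal is `⊤` or has a socle element modulo it. -/
theorem exists_socle_element {I : Ideal A} {n : ℕ} (hI : maximalIdeal A ^ n ≤ I) (hne : I ≠ ⊤) :
    ∃ b, b ∉ I ∧ ∀ c ∈ maximalIdeal A, c * b ∈ I := by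
  classical
  have hex : ∃ n, maximalIdeal A ^ n ≤ I := ⟨n, hI⟩
  have hspec := Nat.find_spec hex
  -- The least exponent is positive since `I ≠ ⊤`; any element of the preceding power outside `I`
  -- will do.
  obtain ⟨k, hk⟩ : ∃ k, Nat.find hex = k + 1 := by
    refine Nat.exists_eq_succ_of_ne_zero fun h0 => hne ?_
    rw [h0, pow_zero, Ideal.one_eq_top] at hspec
    exact top_le_iff.mp hspec
  have hmin := Nat.find_min hex (m := k) (by omega)
  obtain ⟨b, hb, hbI⟩ := Set.not_subset.mp hmin
  refine ⟨b, hbI, fun c hc => hspec ?_⟩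
  rw [hk, pow_succ']
  exact Ideal.mul_mem_mul hc hb

/-! ### The action of the completion -/

theorem exists_eval_eq (f : LocalCompletion A) (n : ℕ) :
    ∃ a : A, AdicCompletion.evalₐ (maximalIdeal A) n f = Ideal.Quotient.mk _ a := by
  obtain ⟨a, ha⟩ := Ideal.Quotient.mk_surjective (AdicCompletion.evalₐ (maximalIdeal A) n f)
  exact ⟨a, ha.symm⟩

theorem eval_eq_of_le {f : LocalCompletion A} {m n : ℕ} (hmn : m ≤ n) {a : A}
    (ha : AdicCompletion.evalₐ (maximalIdeal A) n f = Ideal.Quotient.mk _ a) :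
    AdicCompletion.evalₐ (maximalIdeal A) m f = Ideal.Quotient.mk _ a := by
  obtain ⟨s, rfl⟩ := AdicCompletion.mk_surjective _ _ f
  rw [AdicCompletion.evalₐ_mk] at ha ⊢
  rw [← AdicCompletion.Ideal.mk_eq_mk _ hmn]
  rw [Ideal.Quotient.eq] at ha ⊢
  exact Ideal.pow_le_pow_right hmn ha

/-- Makes the action independent of the truncation level and of the representative. -/
theorem smul_eq_smul_of_eval {f : LocalCompletion A} {m n : ℕ} {a b : A} {x : E}
    (ha : AdicCompletion.evalₐ (maximalIdeal A) m f = Ideal.Quotient.mk _ a)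
    (hb : AdicCompletion.evalₐ (maximalIdeal A) n f = Ideal.Quotient.mk _ b)
    (hm : x ∈ killedBy E (maximalIdeal A ^ m)) (hn : x ∈ killedBy E (maximalIdeal A ^ n)) :
    a • x = b • x := by
  wlog hmn : m ≤ n generalizing m n a b
  · exact (this hb ha hn hm (le_of_not_ge hmn)).symm
  have := (ha.symm.trans (eval_eq_of_le hmn hb))
  rw [Ideal.Quotient.eq] at this
  rw [← sub_eq_zero, ← sub_smul]
  exact hm _ this

/-- The action of an element of the completion on an element of `E`. -/
noncomputable def completionSMul (hE : IsMatlisModule A e) (f : LocalCompletion A) (x : E) : E :=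
  (exists_eval_eq f (hE.torsion x).choose).choose • x

theorem completionSMul_eq (hE : IsMatlisModule A e) {f : LocalCompletion A} {x : E} {n : ℕ} {a : A}
    (hx : x ∈ killedBy E (maximalIdeal A ^ n))
    (ha : AdicCompletion.evalₐ (maximalIdeal A) n f = Ideal.Quotient.mk _ a) :
    hE.completionSMul f x = a • x :=
  smul_eq_smul_of_eval (exists_eval_eq f (hE.torsion x).choose).choose_spec ha
    (hE.torsion x).choose_spec hx

/-- The action of the completion on `E`. -/
noncomputable def completionToEnd (hE : IsMatlisModule A e) :
    LocalCompletion A →+* Module.End A E where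
  toFun f :=
    { toFun := hE.completionSMul f
      map_add' := fun x y => by
        obtain ⟨n, hn⟩ := hE.torsion x
        obtain ⟨m, hm⟩ := hE.torsion y
        have hx : x ∈ killedBy E (maximalIdeal A ^ (n + m)) :=
          killedBy_anti (Ideal.pow_le_pow_right (Nat.le_add_right n m)) hn
        have hy : y ∈ killedBy E (maximalIdeal A ^ (n + m)) :=
          killedBy_anti (Ideal.pow_le_pow_right (Nat.le_add_left m n)) hm
        obtain ⟨a, ha⟩ := exists_eval_eq f (n + m)
        rw [hE.completionSMul_eq hx ha, hE.completionSMul_eq hy ha,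
          hE.completionSMul_eq (add_mem hx hy) ha, smul_add]
      map_smul' := fun c x => by
        obtain ⟨n, hn⟩ := hE.torsion x
        obtain ⟨a, ha⟩ := exists_eval_eq f n
        rw [hE.completionSMul_eq hn ha,
          hE.completionSMul_eq ((killedBy E (maximalIdeal A ^ n)).smul_mem c hn) ha, smul_comm,
          RingHom.id_apply] }
  map_one' := LinearMap.ext fun x => by
    obtain ⟨n, hn⟩ := hE.torsion x
    change hE.completionSMul 1 x = x
    rw [hE.completionSMul_eq (a := 1) hn (by simp), one_smul]
  map_zero' := LinearMap.ext fun x => by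
    obtain ⟨n, hn⟩ := hE.torsion x
    change hE.completionSMul 0 x = 0
    rw [hE.completionSMul_eq (a := 0) hn (by simp), zero_smul]
  map_add' f g := LinearMap.ext fun x => by
    obtain ⟨n, hn⟩ := hE.torsion x
    obtain ⟨a, ha⟩ := exists_eval_eq f n
    obtain ⟨b, hb⟩ := exists_eval_eq g n
    change hE.completionSMul (f + g) x = hE.completionSMul f x + hE.completionSMul g x
    rw [hE.completionSMul_eq hn ha, hE.completionSMul_eq hn hb,
      hE.completionSMul_eq (a := a + b) hn (by rw [map_add, ha, hb, map_add]), add_smul]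
  map_mul' f g := LinearMap.ext fun x => by
    obtain ⟨n, hn⟩ := hE.torsion x
    obtain ⟨a, ha⟩ := exists_eval_eq f n
    obtain ⟨b, hb⟩ := exists_eval_eq g n
    change hE.completionSMul (f * g) x = hE.completionSMul f (hE.completionSMul g x)
    rw [hE.completionSMul_eq hn hb,
      hE.completionSMul_eq ((killedBy E (maximalIdeal A ^ n)).smul_mem b hn) ha,
      hE.completionSMul_eq (a := a * b) hn (by rw [map_mul, ha, hb, map_mul]), mul_smul]

theorem completionToEnd_apply (hE : IsMatlisModule A e) {f : LocalCompletion A} {x : E} {n : ℕ}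
    {a : A} (hx : x ∈ killedBy E (maximalIdeal A ^ n))
    (ha : AdicCompletion.evalₐ (maximalIdeal A) n f = Ideal.Quotient.mk _ a) :
    hE.completionToEnd f x = a • x :=
  hE.completionSMul_eq hx ha

theorem completionToEnd_algebraMap (hE : IsMatlisModule A e) (a : A) (x : E) :
    hE.completionToEnd (algebraMap A _ a) x = a • x := by
  obtain ⟨n, hn⟩ := hE.torsion x
  exact hE.completionToEnd_apply hn (AlgHom.commutes _ a)

theorem completionToEnd_injective (hE : IsMatlisModule A e) :
    Function.Injective hE.completionToEnd := by
  rw [injective_iff_map_eq_zero]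
  intro f hf
  refine AdicCompletion.ext_evalₐ fun n => ?_
  obtain ⟨a, ha⟩ := exists_eval_eq f n
  rw [ha, map_zero, Ideal.Quotient.eq_zero_iff_mem]
  refine hE.mem_of_forall_smul_eq_zero fun x hx => ?_
  rw [← hE.completionToEnd_apply hx ha, hf, LinearMap.zero_apply]

/-! ### Submodules of `E` encoded as ideals of the Rees algebra -/

/-- The homogeneous ideal of the Rees algebra associated with a submodule of `E`. -/
noncomputable def reesAnnihilator (V : Submodule A E) : Ideal (reesAlgebra (maximalIdeal A)) where
  carrier := {p | ∀ n, ∀ v ∈ V, v ∈ killedBy E (maximalIdeal A ^ (n + 1)) →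
    (p : Polynomial A).coeff n • v = 0}
  add_mem' hp hq n v hv hvn := by
    rw [Subalgebra.coe_add, Polynomial.coeff_add, add_smul, hp n v hv hvn, hq n v hv hvn, add_zero]
  zero_mem' n v _ _ := by simp
  smul_mem' p q hq n v hv hvn := by
    rw [smul_eq_mul, Subalgebra.coe_mul, Polynomial.coeff_mul, Finset.sum_smul]
    refine Finset.sum_eq_zero fun ij hij => ?_
    rw [Finset.HasAntidiagonal.mem_antidiagonal] at hij
    rw [mul_comm, mul_smul]
    refine hq _ _ (V.smul_mem _ hv) fun b hb => ?_
    rw [smul_smul]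
    refine hvn _ ?_
    rw [← hij, show ij.1 + ij.2 + 1 = (ij.2 + 1) + ij.1 by omega, pow_add]
    exact Ideal.mul_mem_mul hb ((mem_reesAlgebra_iff _ _).mp p.2 _)

theorem reesAnnihilator_anti {V W : Submodule A E} (h : V ≤ W) :
    reesAnnihilator W ≤ reesAnnihilator V :=
  fun _ hp n v hv hvn => hp n v (h hv) hvn

theorem smul_eq_zero_of_reesAnnihilator_le {V W : Submodule A E}
    (h : reesAnnihilator V ≤ reesAnnihilator W) {n : ℕ} {a : A} (ha : a ∈ maximalIdeal A ^ n)
    (haV : ∀ v ∈ V, v ∈ killedBy E (maximalIdeal A ^ (n + 1)) → a • v = 0) {w : E} (hw : w ∈ W)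
    (hwn : w ∈ killedBy E (maximalIdeal A ^ (n + 1))) : a • w = 0 := by
  have hp : Polynomial.monomial n a ∈ reesAlgebra (maximalIdeal A) :=
    (mem_reesAlgebra_iff _ _).mpr fun i => by
      rw [Polynomial.coeff_monomial]
      split_ifs with hi
      · exact hi ▸ ha
      · exact zero_mem _
  have := h (x := ⟨_, hp⟩) (fun i v hv hvi => by
    change (Polynomial.monomial n a).coeff i • v = 0
    rw [Polynomial.coeff_monomial]
    split_ifs with hi
    · subst hi
      exact haV v hv hvi
    · exact zero_smul _ _) n w hw hwn
  simpa using this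

/-! ### Matlis duality over a Noetherian ring -/

variable [IsNoetherianRing A]

/-- Endomorphisms of `E` act on the part of `E` killed by a primary ideal as ring elements. -/
theorem exists_forall_killedBy_eq_smul (hE : IsMatlisModule A e) (h : E →ₗ[A] E) {n : ℕ}
    (I : Ideal A) (hI : maximalIdeal A ^ n ≤ I) :
    ∃ a : A, ∀ x ∈ killedBy E I, h x = a • x := by
  induction I using WellFoundedGT.induction with
  | ind I ih =>
  by_cases hne : I = ⊤
  · refine ⟨0, fun x hx => ?_⟩
    have : x = 0 := by simpa using hx 1 (by rw [hne]; trivial)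
    simp [this]
  obtain ⟨b, hbI, hb⟩ := exists_socle_element hI hne
  have hlt : I < I ⊔ Ideal.span {b} :=
    left_lt_sup.mpr fun hle => hbI (hle (Ideal.mem_span_singleton_self b))
  obtain ⟨a, ha⟩ := ih _ hlt (hI.trans hlt.le)
  -- On the part of `E` killed by `I`, the error `h - a` vanishes where `b` does, so it factors
  -- through `b`. As `b • x` lies in the socle `A e`, the factor acts there as a scalar `d`, and `a
  -- + d * b` corrects `a`.
  have hker : ∀ x ∈ killedBy E I, b • x = 0 → h x - a • x = 0 := by
    intro x hx hbx
    rw [sub_eq_zero]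
    refine ha x fun c hc => ?_
    obtain ⟨i, hi, j, hj, rfl⟩ := Submodule.mem_sup.mp hc
    obtain ⟨d, rfl⟩ := Ideal.mem_span_singleton'.mp hj
    rw [add_smul, hx i hi, mul_smul, hbx, smul_zero, add_zero]
  obtain ⟨k, hk⟩ := hE.injective.exists_factor
    (b • (killedBy E I).subtype) ((h - a • LinearMap.id) ∘ₗ (killedBy E I).subtype) (by
      intro x hx
      simpa using hker x x.2 (by simpa using hx))
  obtain ⟨d, hd⟩ := hE.socle (k e) fun c hc => by
    rw [← map_smul, hE.smul_eq_zero c hc, map_zero]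
  refine ⟨a + d * b, fun x hx => ?_⟩
  have h1 : k (b • x) = h x - a • x := by simpa using hk ⟨x, hx⟩
  obtain ⟨c, hc⟩ := hE.socle (b • x) fun t ht => by
    rw [smul_smul]; exact hx _ (hb t ht)
  rw [add_smul, mul_smul, hc, smul_comm d c, ← hd, ← map_smul, ← hc, h1]
  abel

theorem completionToEnd_surjective (hE : IsMatlisModule A e) :
    Function.Surjective hE.completionToEnd := by
  intro h
  choose a ha using fun n : ℕ =>
    hE.exists_forall_killedBy_eq_smul h (n := n) (maximalIdeal A ^ n) le_rfl
  refine ⟨AdicCompletion.mk _ _ (AdicCompletion.AdicCauchySequence.mk _ _ a fun n => ?_), ?_⟩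
  · rw [SModEq.sub_mem, smul_eq_mul, Ideal.mul_top]
    -- Consecutive scalars agree on the part killed by the `n`-th power, so the double annihilator
    -- property puts their difference in that power.
    refine hE.mem_of_forall_smul_eq_zero fun x hx => ?_
    rw [sub_smul, sub_eq_zero, ← ha n x hx,
      ← ha (n + 1) x (killedBy_anti (Ideal.pow_le_pow_right n.le_succ) hx)]
  · ext x
    obtain ⟨n, hn⟩ := hE.torsion x
    rw [hE.completionToEnd_apply hn (AdicCompletion.evalₐ_mk _ n _)]
    exact (ha n x hn).symm

theorem le_of_reesAnnihilator_le (hE : IsMatlisModule A e) {V W : Submodule A E} (hVW : V ≤ W)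
    (h : reesAnnihilator V ≤ reesAnnihilator W) : W ≤ V := by
  suffices key : ∀ n, ∀ w ∈ W, w ∈ killedBy E (maximalIdeal A ^ n) → w ∈ V by
    intro w hw
    obtain ⟨n, hn⟩ := hE.torsion w
    exact key n w hw hn
  classical
  intro n
  induction n with
  | zero =>
    intro w _ hwn
    have : w = 0 := by simpa using hwn 1 (by simp)
    rw [this]
    exact V.zero_mem
  | succ n ih =>
    intro w hw hwn
    obtain ⟨s, hs⟩ := IsNoetherian.noetherian (maximalIdeal A ^ n)
    -- multiplication by the generators
    let μ : E →ₗ[A] (s → E) := LinearMap.pi fun a : s => (a : A) • LinearMap.id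
    have hsm : ∀ a : s, (a : A) ∈ maximalIdeal A ^ n := fun a => hs ▸ Submodule.subset_span a.2
    have hsoc : ∀ v ∈ killedBy E (maximalIdeal A ^ (n + 1)), ∀ a ∈ maximalIdeal A ^ n,
        ∃ c : A, a • v = c • e := fun v hv a ha => hE.socle _ fun t ht => by
      rw [smul_smul]
      refine hv _ ?_
      rw [pow_succ']
      exact Ideal.mul_mem_mul ht ha
    -- The kernel of `μ` is the part killed by the `n`-th power, so a `v ∈ V` with the same image as
    -- `w` reduces the claim to the induction hypothesis.
    by_cases hmem : μ w ∈ (V ⊓ killedBy E (maximalIdeal A ^ (n + 1))).map μ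
    · obtain ⟨v, ⟨hv, hvn⟩, hvw⟩ := hmem
      have hdiff : w - v ∈ V := by
        refine ih _ (W.sub_mem hw (hVW hv)) ?_
        have hle : maximalIdeal A ^ n ≤ LinearMap.ker (LinearMap.toSpanSingleton A E (w - v)) := by
          rw [← hs, Submodule.span_le]
          intro a ha
          have := congrFun hvw ⟨a, ha⟩
          simp only [μ, LinearMap.pi_apply, LinearMap.smul_apply, LinearMap.id_apply] at this
          simp [smul_sub, this]
        intro a ha
        simpa using hle ha
      simpa using V.add_mem hdiff hv
    · exfalso
      obtain ⟨φ, h1, h2⟩ := hE.exists_apply_ne_zero_of_notMem hmem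
      have hφ : ∀ x : s → E, φ x = ∑ a, φ (LinearMap.single A (fun _ => E) a (x a)) := fun x => by
        simp only [← map_sum, LinearMap.coe_single, LinearMap.sum_single_apply]
      -- `μ` sends elements killed by the `(n+1)`-st power into copies of the socle, where each
      -- component of `φ` is a scalar. So `φ ∘ μ` is a ring element of degree `n` killing `V` there
      -- but not `w`.
      choose c hc using fun a : s => hE.socle (φ (LinearMap.single A (fun _ => E) a e))
        fun t ht => by rw [← map_smul, ← map_smul, hE.smul_eq_zero t ht, map_zero, map_zero]
      have hφμ : ∀ v ∈ killedBy E (maximalIdeal A ^ (n + 1)),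
          φ (μ v) = (∑ a : s, c a * (a : A)) • v := fun v hv => by
        rw [hφ, Finset.sum_smul]
        refine Finset.sum_congr rfl fun a _ => ?_
        obtain ⟨d, hd⟩ := hsoc v hv a (hsm a)
        have : μ v a = d • e := hd
        rw [this, map_smul, map_smul, hc, mul_smul, hd, smul_comm]
      refine h2 ?_
      rw [hφμ w hwn]
      refine smul_eq_zero_of_reesAnnihilator_le h
        (Ideal.sum_mem _ fun a _ => Ideal.mul_mem_left _ _ (hsm a)) (fun v hv hvn => ?_) hw hwn
      rw [← hφμ v hvn]
      exact h1 _ (Submodule.mem_map_of_mem ⟨hv, hvn⟩)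

/-- The Rees algebra is Noetherian, and `reesAnnihilator` reverses strict inclusions. -/
theorem isArtinian (hE : IsMatlisModule A e) : IsArtinian A E := by
  have : StrictAnti (reesAnnihilator : Submodule A E → _) := fun V W hVW =>
    lt_of_le_not_ge (reesAnnihilator_anti hVW.le)
      fun h => hVW.not_ge (hE.le_of_reesAnnihilator_le hVW.le h)
  exact ⟨this.wellFoundedLT.wf⟩

/-- If `g` kills the kernel of `f`, then `f` divides `g` in the completion. -/
theorem dvd_of_ker_le (hE : IsMatlisModule A e) {f g : LocalCompletion A}
    (h : LinearMap.ker (hE.completionToEnd f) ≤ LinearMap.ker (hE.completionToEnd g)) : f ∣ g := by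
  obtain ⟨k, hk⟩ := hE.injective.exists_factor _ _ h
  obtain ⟨k, rfl⟩ := hE.completionToEnd_surjective k
  refine ⟨k, hE.completionToEnd_injective ?_⟩
  rw [mul_comm, map_mul]
  exact LinearMap.ext fun x => (hk x).symm

/-! ### The hull of `R/q` as a Matlis module over `R_q` -/

section Hull

variable {R : Type u} [CommRing R] {q : Ideal R} {N : Type u}
  [AddCommGroup N] [Module R N] {i : (R ⧸ q) →ₗ[R] N}

theorem injective_of_isLocalization (A : Type u) [CommRing A] [Algebra R A] [Module A N]
    [IsScalarTower R A N] (S : Submonoid R) [IsLocalization S A] (h : Module.Injective R N) :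
    Module.Injective A N := by
  refine Module.Baer.injective fun I g => ?_
  obtain ⟨k, hk⟩ := h.out ((Submodule.subtype I).restrictScalars R) (Submodule.subtype_injective I)
    (g.restrictScalars R)
  exact ⟨k.extendScalarsOfIsLocalization S A, fun x hx => hk ⟨x, hx⟩⟩

theorem exists_smul_eq_of_essential (hi : IsInjectiveHull i) {x : N} (hx : x ≠ 0) :
    ∃ r s : R, s ∉ q ∧ r • x = s • i 1 := by
  have h := hi.essential (Submodule.span R {x}) (by simpa using hx)
  obtain ⟨y, ⟨⟨z, rfl⟩, hy2⟩, hy0⟩ := Submodule.exists_mem_ne_zero_of_ne_bot h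
  obtain ⟨r, hr⟩ := Submodule.mem_span_singleton.mp hy2
  obtain ⟨s, rfl⟩ := Ideal.Quotient.mk_surjective z
  refine ⟨r, s, fun hs => hy0 ?_, ?_⟩
  · rw [Ideal.Quotient.eq_zero_iff_mem.mpr hs, map_zero]
  · rw [hr, ← map_smul, Algebra.smul_def, mul_one]
    rfl

theorem smul_apply_one_eq_zero_iff (hi : IsInjectiveHull i) {s : R} : s • i 1 = 0 ↔ s ∈ q := by
  rw [← map_smul, map_eq_zero_iff i hi.injective, Algebra.smul_def, mul_one]
  exact Ideal.Quotient.eq_zero_iff_mem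

theorem exists_pow_smul_eq_zero [IsNoetherianRing R] (hi : IsInjectiveHull i) {b : R} (hb : b ∈ q)
    (x : N) : ∃ n, b ^ n • x = 0 := by
  let f : ℕ →o Ideal R :=
    ⟨fun n => LinearMap.ker (LinearMap.toSpanSingleton R N (b ^ n • x)),
      monotone_nat_of_le_succ fun n c hc => by
        simp only [LinearMap.mem_ker, LinearMap.toSpanSingleton_apply] at hc ⊢
        rw [pow_succ', mul_smul, smul_comm, hc, smul_zero]⟩
  obtain ⟨n, hn⟩ := monotone_stabilizes_iff_noetherian.mpr ‹_› f
  refine ⟨n, ?_⟩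
  by_contra hne
  obtain ⟨r, t, ht, hrt⟩ := exists_smul_eq_of_essential hi hne
  -- `r` sends `b ^ n • x` to a nonzero element of `R/q`, which `b` kills; stability of the
  -- annihilators then makes `r` kill `b ^ n • x` itself.
  have h1 : r ∈ f (n + 1) := by
    change r • (b ^ (n + 1) • x) = 0
    rw [pow_succ', mul_smul, smul_comm, hrt, smul_smul]
    exact (smul_apply_one_eq_zero_iff hi).mpr (q.mul_mem_right _ hb)
  rw [← hn (n + 1) n.le_succ] at h1
  have h2 : r • (b ^ n • x) = 0 := h1
  rw [hrt] at h2
  exact ht ((smul_apply_one_eq_zero_iff hi).mp h2)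

theorem exists_ideal_pow_smul_eq_zero [IsNoetherianRing R] (hi : IsInjectiveHull i) (x : N) :
    ∃ n, ∀ b ∈ q ^ n, b • x = 0 := by
  obtain ⟨n, hn⟩ := Ideal.exists_pow_le_of_le_radical_of_fg
    (I := q) (J := LinearMap.ker (LinearMap.toSpanSingleton R N x))
    (fun b hb => by
      obtain ⟨n, hn⟩ := exists_pow_smul_eq_zero hi hb x
      exact ⟨n, by simpa using hn⟩) (IsNoetherian.noetherian q)
  exact ⟨n, fun b hb => by simpa using hn hb⟩

variable [q.IsPrime]

theorem eq_zero_of_smul_eq_zero (hi : IsInjectiveHull i) {s : R} (hs : s ∉ q) {x : N}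
    (hx : s • x = 0) : x = 0 := by
  by_contra hne
  obtain ⟨r, t, ht, hrt⟩ := exists_smul_eq_of_essential hi hne
  have h1 : (s * t) • i 1 = 0 := by rw [mul_smul, ← hrt, smul_comm, hx, smul_zero]
  rcases Ideal.IsPrime.mem_or_mem ‹_› ((smul_apply_one_eq_zero_iff hi).mp h1) with h | h
  exacts [hs h, ht h]

theorem smul_bijective (hi : IsInjectiveHull i) {s : R} (hs : s ∉ q) :
    Function.Bijective fun x : N => s • x := by
  refine ⟨(injective_iff_map_eq_zero (s • LinearMap.id : N →ₗ[R] N)).mpr fun x hx =>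
    eq_zero_of_smul_eq_zero hi hs hx, fun x => ?_⟩
  obtain ⟨g, hg⟩ := hi.injective_module.exists_factor (s • LinearMap.id : N →ₗ[R] N) LinearMap.id
    fun x hx => eq_zero_of_smul_eq_zero hi hs (by simpa using hx)
  refine ⟨g x, ?_⟩
  change s • g x = x
  rw [← map_smul]
  exact hg x

theorem isLocalizedModule_id (hi : IsInjectiveHull i) :
    IsLocalizedModule q.primeCompl (LinearMap.id : N →ₗ[R] N) where
  map_units s := (Module.End.isUnit_iff _).mpr (smul_bijective hi s.2)
  surj y := ⟨(y, 1), by simp⟩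
  exists_of_eq h := ⟨1, by simpa using h⟩

variable (A : Type u) [CommRing A] [IsLocalRing A] [Algebra R A] [IsLocalization.AtPrime A q]
  [Module A N] [IsScalarTower R A N]

theorem of_isInjectiveHull [IsNoetherianRing R] (hi : IsInjectiveHull i) :
    IsMatlisModule A (i 1) where
  injective := injective_of_isLocalization A q.primeCompl hi.injective_module
  ne_zero h := by
    have := (smul_apply_one_eq_zero_iff hi (s := 1)).mp (by rw [h, smul_zero])
    exact (Ideal.ne_top_iff_one q).mp (Ideal.IsPrime.ne_top ‹_›) this
  smul_eq_zero a ha := by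
    rw [← IsLocalization.AtPrime.map_eq_maximalIdeal q A] at ha
    have hle : q.map (algebraMap R A) ≤ LinearMap.ker (LinearMap.toSpanSingleton A N (i 1)) :=
      Ideal.map_le_iff_le_comap.mpr fun b hb => by
        simpa using (smul_apply_one_eq_zero_iff hi).mpr hb
    simpa using hle ha
  socle x hx := by
    by_cases h0 : x = 0
    · exact ⟨0, by rw [h0, zero_smul]⟩
    obtain ⟨r, s, hs, hrs⟩ := exists_smul_eq_of_essential hi h0
    have hr : r ∉ q := fun hr => by
      rw [← algebraMap_smul A r x, hx] at hrs
      · exact hs ((smul_apply_one_eq_zero_iff hi).mp hrs.symm)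
      · exact (IsLocalization.AtPrime.to_map_mem_maximal_iff A q r).mpr hr
    obtain ⟨u, hu⟩ := (IsLocalization.map_units A (⟨r, hr⟩ : q.primeCompl))
    refine ⟨↑u⁻¹ * algebraMap R A s, ?_⟩
    rw [mul_smul, algebraMap_smul, ← hrs, ← algebraMap_smul A r x]
    change x = u⁻¹ • (algebraMap R A (⟨r, hr⟩ : q.primeCompl) • x)
    rw [← hu]
    exact (inv_smul_smul u x).symm
  torsion x := by
    obtain ⟨n, hn⟩ := exists_ideal_pow_smul_eq_zero hi x
    refine ⟨n, fun a ha => ?_⟩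
    rw [← IsLocalization.AtPrime.map_eq_maximalIdeal q A, ← Ideal.map_pow] at ha
    have hle : (q ^ n).map (algebraMap R A) ≤ LinearMap.ker (LinearMap.toSpanSingleton A N x) :=
      Ideal.map_le_iff_le_comap.mpr fun b hb => by simpa using hn b hb
    simpa using hle ha

end Hull

/-! ### Simple divisibility and the completion -/

section Divisible

variable {R A E : Type u} [CommRing R] [CommRing A] [IsLocalRing A]
  [AddCommGroup E] [Module A E] {e : E} [Algebra R A] [Module R E] [IsScalarTower R A E]

theorem isDivisibleModule_of_injective (h : Module.Injective R E) : IsDivisibleModule R E := by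
  intro r hr x
  obtain ⟨k, hk⟩ := h.exists_factor (LinearMap.toSpanSingleton R R r)
    (LinearMap.toSpanSingleton R E x) fun a ha => by
      have h0 : a = 0 := (mem_nonZeroDivisors_iff.mp hr).2 a (by simpa using ha)
      rw [h0]
      exact zero_mem _
  refine ⟨k 1, ?_⟩
  have := hk 1
  simp only [LinearMap.toSpanSingleton_apply, one_smul] at this
  change r • k 1 = x
  rw [← map_smul, smul_eq_mul, mul_one, this]

theorem surjective_of_isSimpleDivisible (hE : IsMatlisModule A e) (hS : IsSimpleDivisible R E)
    {f : LocalCompletion A} (hf : f ≠ 0) : Function.Surjective (hE.completionToEnd f) := by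
  rw [← LinearMap.range_eq_top]
  by_contra hne
  refine hS.not_divisible ((LinearMap.range (hE.completionToEnd f)).restrictScalars R) ?_ ?_ ?_
  · rw [Ne, Submodule.restrictScalars_eq_bot_iff, LinearMap.range_eq_bot]
    exact fun h => hf (hE.completionToEnd_injective (h.trans (map_zero _).symm))
  · rwa [Ne, Submodule.restrictScalars_eq_top_iff]
  · rintro r hr ⟨_, y, rfl⟩
    obtain ⟨z, rfl⟩ := hS.divisible r hr y
    refine ⟨⟨hE.completionToEnd f z, z, rfl⟩, Subtype.ext ?_⟩
    change r • _ = hE.completionToEnd f (r • z)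
    rw [LinearMap.map_smul_of_tower]

theorem isAnalyticallyIrreducible (hE : IsMatlisModule A e) (hS : IsSimpleDivisible R E) :
    IsAnalyticallyIrreducible A := by
  have : Nontrivial (LocalCompletion A) := by
    refine ⟨1, 0, fun h => hE.ne_zero ?_⟩
    have := congrArg (fun f => hE.completionToEnd f e) h
    simpa using this
  have : NoZeroDivisors (LocalCompletion A) := by
    refine ⟨fun {f g} hfg => ?_⟩
    by_contra! hne
    obtain ⟨y, hy⟩ := hE.surjective_of_isSimpleDivisible hS hne.1 e
    obtain ⟨z, rfl⟩ := hE.surjective_of_isSimpleDivisible hS hne.2 y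
    refine hE.ne_zero ?_
    rw [← hy, ← Module.End.mul_apply, ← map_mul, hfg, map_zero, LinearMap.zero_apply]
  exact NoZeroDivisors.to_isDomain _

variable [IsNoetherianRing A]

theorem exists_ne_zero_dvd (hE : IsMatlisModule A e) (S : Submonoid R) [IsLocalization S A]
    (hS : IsSimpleDivisible R E) {f : LocalCompletion A} (hf : f ≠ 0) :
    ∃ a : A, a ≠ 0 ∧ f ∣ algebraMap A _ a := by
  have hart := hE.isArtinian
  let U := LinearMap.ker (hE.completionToEnd f)
  let m (r : R) : E →ₗ[A] E := algebraMap R A r • LinearMap.id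
  obtain ⟨V, ⟨s, hs, rfl⟩, hmin⟩ := IsArtinian.set_has_minimal
    {V : Submodule A E | ∃ s ∈ nonZeroDivisors R, V = U.map (m s)}
    ⟨_, 1, one_mem _, rfl⟩
  refine ⟨algebraMap R A s, ?_, hE.dvd_of_ker_le fun x hx => ?_⟩
  · exact nonZeroDivisors.ne_zero (IsLocalization.map_nonZeroDivisors_le S A ⟨s, hs, rfl⟩)
  rw [LinearMap.mem_ker, hE.completionToEnd_algebraMap]
  by_contra hne
  have hle : U.map (m s) ≤ U := by
    rintro _ ⟨y, hy, rfl⟩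
    exact U.smul_mem _ hy
  refine hS.not_divisible ((U.map (m s)).restrictScalars R) ?_ ?_ ?_
  · rw [Ne, Submodule.restrictScalars_eq_bot_iff]
    intro h
    have : algebraMap R A s • x ∈ U.map (m s) := ⟨x, hx, rfl⟩
    rw [h] at this
    exact hne this
  · rw [Ne, Submodule.restrictScalars_eq_top_iff]
    intro h
    rw [h, top_le_iff, LinearMap.ker_eq_top] at hle
    exact hf (hE.completionToEnd_injective (hle.trans (map_zero _).symm))
  · rintro r hr ⟨x, hx⟩
    have hle2 : U.map (m (r * s)) ≤ U.map (m s) := by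
      rintro _ ⟨y, hy, rfl⟩
      refine ⟨algebraMap R A r • y, U.smul_mem _ hy, ?_⟩
      simp [m, smul_smul, mul_comm]
    -- Minimality of `s U` gives `r s U = s U`, which is divisibility.
    have heq : U.map (m (r * s)) = U.map (m s) :=
      hle2.eq_of_not_lt (hmin _ ⟨r * s, mul_mem hr hs, rfl⟩)
    obtain ⟨y, hy, rfl⟩ : x ∈ U.map (m (r * s)) := heq ▸ hx
    refine ⟨⟨m s y, y, hy, rfl⟩, Subtype.ext ?_⟩
    change r • (algebraMap R A s • y) = algebraMap R A (r * s) • y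
    rw [map_mul, mul_smul, algebraMap_smul, algebraMap_smul]

theorem isEssentiallyComplete (hE : IsMatlisModule A e) (S : Submonoid R) [IsLocalization S A]
    (hS : IsSimpleDivisible R E) : IsEssentiallyComplete A := by
  have hdom : IsDomain (LocalCompletion A) := hE.isAnalyticallyIrreducible hS
  have hinj : Function.Injective (algebraMap A (LocalCompletion A)) :=
    AdicCompletion.of_injective (maximalIdeal A) A
  intro I hI V hV
  obtain ⟨f, ⟨hfI, -⟩, hf0⟩ := Submodule.exists_mem_ne_zero_of_ne_bot (hI ⊤ top_ne_bot)
  obtain ⟨a, ha, hfa⟩ := hE.exists_ne_zero_dvd S hS hf0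
  obtain ⟨v, hv, hv0⟩ := Submodule.exists_mem_ne_zero_of_ne_bot hV
  have haI : a ∈ I.comap (algebraMap A (LocalCompletion A)) := I.mem_of_dvd hfa hfI
  refine (Submodule.ne_bot_iff _).mpr ⟨a * v, ⟨Ideal.mul_mem_right _ _ haI, V.smul_mem a hv⟩, ?_⟩
  intro h0
  have h1 := congrArg (algebraMap A (LocalCompletion A)) h0
  rw [map_mul, map_zero, mul_eq_zero, map_eq_zero_iff _ hinj, map_eq_zero_iff _ hinj] at h1
  exact h1.elim ha hv0

theorem isSimpleDivisible (hE : IsMatlisModule A e) (S : Submonoid R) [IsLocalization S A]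
    (hinj : Function.Injective (algebraMap R A)) (hR : Module.Injective R E)
    (hirr : IsAnalyticallyIrreducible A) (hess : IsEssentiallyComplete A) :
    IsSimpleDivisible R E where
  nontrivial := ⟨e, 0, hE.ne_zero⟩
  divisible := isDivisibleModule_of_injective hR
  not_divisible U hbot htop hdiv := by
    have hdom : IsDomain (LocalCompletion A) := hirr
    have hcinj : Function.Injective (algebraMap A (LocalCompletion A)) :=
      AdicCompletion.of_injective (maximalIdeal A) A
    have hA : IsDomain A := hcinj.isDomain
    have hRdom : IsDomain R := hinj.isDomain
    have hdvd : ∀ r : R, r ≠ 0 → ∀ x ∈ U, ∃ y ∈ U, r • y = x := fun r hr x hx => by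
      obtain ⟨y, hy⟩ := hdiv r (mem_nonZeroDivisors_of_ne_zero hr) ⟨x, hx⟩
      exact ⟨y, y.2, congrArg Subtype.val hy⟩
    have hunit (s : S) : (s : R) ≠ 0 := fun h => by
      have := IsLocalization.map_units A s
      rw [h, map_zero] at this
      exact not_isUnit_zero this
    -- A divisible `U` is stable under `A`: writing `x = s y` with `y ∈ U` gives `(r/s) x = r y`.
    let W : Submodule A E :=
      { U with
        smul_mem' := fun a x hx => by
          obtain ⟨r, s, rfl⟩ := IsLocalization.exists_mk'_eq S a
          obtain ⟨y, hy, rfl⟩ := hdvd s (hunit s) x hx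
          rw [← algebraMap_smul A (s : R) y, smul_smul, IsLocalization.mk'_spec, algebraMap_smul]
          exact U.smul_mem r hy }
    obtain ⟨x, hx⟩ : ∃ x, x ∉ W := by
      by_contra! h
      exact htop (eq_top_iff.mpr fun x _ => h x)
    obtain ⟨φ, hφ, hφx⟩ := hE.exists_apply_ne_zero_of_notMem hx
    obtain ⟨f, rfl⟩ := hE.completionToEnd_surjective φ
    have hf : f ≠ 0 := by
      rintro rfl
      exact hφx (by simp)
    have hess' : IsEssentialSubmodule (Ideal.span {f}) := fun V hV => by
      obtain ⟨v, hv, hv0⟩ := Submodule.exists_mem_ne_zero_of_ne_bot hV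
      exact (Submodule.ne_bot_iff _).mpr ⟨f * v,
        ⟨Ideal.mul_mem_right _ _ (Ideal.mem_span_singleton_self f), V.smul_mem f hv⟩,
        mul_ne_zero hf hv0⟩
    obtain ⟨a, ⟨ha, -⟩, ha0⟩ :=
      Submodule.exists_mem_ne_zero_of_ne_bot (hess _ hess' ⊤ top_ne_bot)
    obtain ⟨g, hg⟩ := Ideal.mem_span_singleton'.mp (Ideal.mem_comap.mp ha)
    have hkill : ∀ y ∈ U, a • y = 0 := fun y hy => by
      rw [← hE.completionToEnd_algebraMap, ← hg, map_mul, Module.End.mul_apply, hφ y hy, map_zero]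
    obtain ⟨r, s, rfl⟩ := IsLocalization.exists_mk'_eq S a
    have hr : r ≠ 0 := by
      rintro rfl
      exact ha0 (IsLocalization.mk'_zero s)
    -- The numerator `r` also kills `U`, yet `r U = U`.
    obtain ⟨u, hu, hu0⟩ := Submodule.exists_mem_ne_zero_of_ne_bot hbot
    obtain ⟨y, hy, rfl⟩ := hdvd r hr u hu
    refine hu0 ?_
    rw [← algebraMap_smul A r y, ← IsLocalization.mk'_spec A r s, mul_comm, mul_smul, hkill y hy,
      smul_zero]

end Divisible

end IsMatlisModule

theorem mainTheorem1 {R : Type u} [CommRing R] [IsNoetherianRing R] [IsLocalRing R]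
    (q : Ideal R) [q.IsPrime] {N : Type u} [AddCommGroup N] [Module R N]
    (i : (R ⧸ q) →ₗ[R] N) (hi : IsInjectiveHull i) :
    (IsSimpleDivisible R N →
      IsAnalyticallyIrreducible (Localization.AtPrime q) ∧
        IsEssentiallyComplete (Localization.AtPrime q)) ∧
    (Function.Injective (algebraMap R (Localization.AtPrime q)) →
      IsAnalyticallyIrreducible (Localization.AtPrime q) ∧
        IsEssentiallyComplete (Localization.AtPrime q) →
      IsSimpleDivisible R N) := by
  have hloc := IsMatlisModule.isLocalizedModule_id hi
  let : Module (Localization.AtPrime q) N :=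
    IsLocalizedModule.module q.primeCompl (LinearMap.id : N →ₗ[R] N)
  have : IsScalarTower R (Localization.AtPrime q) N :=
    IsLocalizedModule.isScalarTower_module q.primeCompl (LinearMap.id : N →ₗ[R] N)
  have : IsNoetherianRing (Localization.AtPrime q) :=
    IsLocalization.isNoetherianRing q.primeCompl _ ‹_›
  have hE := IsMatlisModule.of_isInjectiveHull (Localization.AtPrime q) hi
  exact ⟨fun hS => ⟨hE.isAnalyticallyIrreducible hS, hE.isEssentiallyComplete q.primeCompl hS⟩,
    fun hinj h => hE.isSimpleDivisible q.primeCompl hinj hi.injective_module h.1 h.2⟩
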